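/- Let $(M,g)$ be an $n$-dimensional smooth pseudo-Riemannian manifold: $g$ is a smooth symmetric nondegenerate bilinear form, of arbitrary signature, on the tangent spaces $T_pM$, written $g(v,w)=v\cdot w$. For $p\in M$ let the geometric tangent space $GT_pM$ be the Clifford algebra of $T_pM$ with $vv=v\cdot v$ for $v\in T_pM$; it contains the scalars $\mathbb{R}$ and the vectors $T_pM$. A multivector field $A$ (with $A(p)\in GT_pM$) is smooth if, in every chart with coordinate vector fields $e_1,\dots,e_n$, its coefficients $A^J$ in $A=\sum_J A^J e_J$ are smooth, where $J=\{j_1<\dots<j_k\}$ ranges over the subsets of $\{1,\dots,n\}$, $e_J=e_{j_1}\wedge\dots\wedge e_{j_k}$ and $e_\emptyset=1$. For a tangent vector $a$ at $p$ and a scalar field $\varphi$, $\partial_a\varphi$ denotes the directional derivative. Below, all fields are only required to be defined and smooth in a neighborhood of $p$. An affine connection $\tilde D$ assigns to every $p\in M$, every $a\in T_pM$ and every vector field $u$ a vector $\tilde D_a u\in T_pM$ such that, for all $a,b\in T_pM$, $\alpha,\beta\in\mathbb{R}$, vector fields $u,v$ and scalar fields $\lambda$: - $\tilde D_{\alpha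 a+\beta b}v=\alpha\tilde D_a v+\beta\tilde D_b v$; - $\tilde D_a(u+v)=\tilde D_a u+\tilde D_a v$; - $\tilde D_a(\lambda v)=(\partial_a\lambda)v+\lambda\,\tilde D_a v$. It is metric-compatible if $(\tilde D_c u)\cdot v+u\cdot(\tilde D_c v)=\partial_c(u\cdot v)$ for all $p$, $c\in T_pM$ and all vector fields $u,v$. A multivector directional derivative (MDD) $D$ assigns to every $p\in M$, every $a\in T_pM$ and every multivector field $A$ a multivector $D_aA\in GT_pM$ such that, for all $a,b\in T_pM$, $\alpha,\beta\in\mathbb{R}$ and multivector fields $A,B$: 1. $D_{\alpha a+\beta b}A=\alpha D_aA+\beta D_bA$; 2. $D_a\varphi=\partial_a\varphi$ for every scalar field $\varphi$; 3. $D_a v\in T_pM$ for every vector field $v$; 4. $D_a(A+B)=D_aA+D_aB$; 5. $D_a(AB)=(D_aA)B+A(D_aB)$. **Theorem (Existence of MDDs).** For every metric-compatible affine connection $\tilde D$ on $M$ there is a multivector directional derivative $D$ with $D_a v=\tilde D_a v$ for all $p\in M$, $a\in T_pM$ and all vector fields $v$. Moreover, if $\tilde D$ maps smooth fields to smooth fields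 (for every open $U\subseteq M$ and all smooth vector fields $a,v$ on $U$ the field $x\mapsto\tilde D_{a(x)}v$ is smooth on $U$), then $D$ does too: $x\mapsto D_{a(x)}A$ is smooth on $U$ for every smooth vector field $a$ and every smooth multivector field $A$ on $U$. -/

import Mathlib

open scoped Manifold ContDiff Topology Bundle

noncomputable section

/-- A pseudo-Riemannian metric on an `n`-dimensional smooth manifold `M`: a smooth field of
symmetric nondegenerate bilinear forms, of arbitrary signature, on the tangent spaces. -/
structure PseudoRiemannianMetric (n : ℕ) (M : Type*) [TopologicalSpace M]
    [ChartedSpace (EuclideanSpace ℝ (Fin n)) M] [IsManifold (𝓡 n) ∞ M] where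
  inner (x : M) : TangentSpace (𝓡 n) x →L[ℝ] TangentSpace (𝓡 n) x →L[ℝ] ℝ
  symm (x : M) (v w : TangentSpace (𝓡 n) x) : inner x v w = inner x w v
  nondegenerate (x : M) (v : TangentSpace (𝓡 n) x) (hv : ∀ w, inner x v w = 0) : v = 0
  contMDiff : ContMDiff (𝓡 n)
    ((𝓡 n).prod 𝓘(ℝ, EuclideanSpace ℝ (Fin n) →L[ℝ] EuclideanSpace ℝ (Fin n) →L[ℝ] ℝ)) ∞
    (fun x ↦ Bundle.TotalSpace.mk'
      (EuclideanSpace ℝ (Fin n) →L[ℝ] EuclideanSpace ℝ (Fin n) →L[ℝ] ℝ) x (inner x))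

section Fields

variable {n : ℕ} {M : Type*} [TopologicalSpace M]
  [ChartedSpace (EuclideanSpace ℝ (Fin n)) M] [IsManifold (𝓡 n) ∞ M]

/-- The quadratic form `v ↦ v · v` on the tangent space at `x`. -/
def PseudoRiemannianMetric.quadraticForm (g : PseudoRiemannianMetric n M) (x : M) :
    QuadraticForm ℝ (TangentSpace (𝓡 n) x) :=
  (g.inner x).toBilinForm.toQuadraticMap

/-- The geometric tangent space at `x`: the Clifford algebra of the tangent space, in which
`v * v = v · v` for every tangent vector `v`. -/
abbrev GeomTangentSpace (g : PseudoRiemannianMetric n M) (x : M) : Type :=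
  CliffordAlgebra (g.quadraticForm x)

/-- A tangent vector at `x`, regarded as a tangent multivector at `x`. -/
def vectorToMultivector (g : PseudoRiemannianMetric n M) (x : M) :
    TangentSpace (𝓡 n) x →ₗ[ℝ] GeomTangentSpace g x :=
  CliffordAlgebra.ι (g.quadraticForm x)

/-- A scalar, regarded as a tangent multivector at `x`. -/
def scalarToMultivector (g : PseudoRiemannianMetric n M) (x : M) :
    ℝ →ₐ[ℝ] GeomTangentSpace g x :=
  Algebra.ofId ℝ (GeomTangentSpace g x)

/-- The wedge product `v 0 ∧ ⋯ ∧ v (k - 1)` of tangent vectors at `x`, as a tangent multivector: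
the Clifford algebra is identified with the exterior algebra as a vector space in the usual way,
so that `v ∧ w = (v w - w v) / 2`. The empty wedge product is `1`. -/
def wedgeVectors (g : PseudoRiemannianMetric n M) (x : M) {k : ℕ}
    (v : Fin k → TangentSpace (𝓡 n) x) : GeomTangentSpace g x :=
  (CliffordAlgebra.equivExterior (g.quadraticForm x)).symm (ExteriorAlgebra.ιMulti ℝ k v)

/-- The `i`-th coordinate vector field `∂ / ∂xⁱ` of the preferred chart at `x₀`. It is meaningful
on the domain of that chart. -/
def coordFrame (x₀ : M) (i : Fin n) (x : M) : TangentSpace (𝓡 n) x :=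
  (trivializationAt (EuclideanSpace ℝ (Fin n)) (TangentSpace (𝓡 n)) x₀).localFrame
    (EuclideanSpace.basisFun (Fin n) ℝ).toBasis i x

/-- The member of the canonical multivector frame of the chart at `x₀` that belongs to the index
set `J`: the wedge product of the coordinate vector fields with index in `J`, in increasing order
of the indices. -/
def multivectorCoordFrame (g : PseudoRiemannianMetric n M) (x₀ : M) (J : Finset (Fin n)) (x : M) :
    GeomTangentSpace g x :=
  wedgeVectors g x (fun k : Fin J.card ↦ coordFrame x₀ (J.orderEmbOfFin rfl k) x)

/-- The multivector field `A` is smooth on `U`: in each chart, its coefficients in the canonical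
multivector frame are smooth on the part of `U` that the chart covers. -/
def SmoothMultivectorFieldOn (g : PseudoRiemannianMetric n M)
    (A : (x : M) → GeomTangentSpace g x) (U : Set M) : Prop :=
  ∀ x₀ : M, ∃ c : Finset (Fin n) → M → ℝ,
    (∀ J, ContMDiffOn (𝓡 n) 𝓘(ℝ, ℝ) ∞ (c J)
      (U ∩ (chartAt (EuclideanSpace ℝ (Fin n)) x₀).source)) ∧
    ∀ x ∈ U ∩ (chartAt (EuclideanSpace ℝ (Fin n)) x₀).source,
      A x = ∑ J, c J x • multivectorCoordFrame g x₀ J x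

/-- The vector field `v` is smooth on `U`. -/
def SmoothVectorFieldOn (v : (x : M) → TangentSpace (𝓡 n) x) (U : Set M) : Prop :=
  ContMDiffOn (𝓡 n) (𝓡 n).tangent ∞
    (fun x ↦ Bundle.TotalSpace.mk' (EuclideanSpace ℝ (Fin n)) x (v x)) U

/-- `A` is a smooth multivector field in a neighborhood of `p`. -/
def SmoothMultivectorFieldNear (g : PseudoRiemannianMetric n M)
    (A : (x : M) → GeomTangentSpace g x) (p : M) : Prop :=
  ∃ U : Set M, IsOpen U ∧ p ∈ U ∧ SmoothMultivectorFieldOn g A U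

/-- `v` is a smooth vector field in a neighborhood of `p`. -/
def SmoothVectorFieldNear (v : (x : M) → TangentSpace (𝓡 n) x) (p : M) : Prop :=
  ∃ U : Set M, IsOpen U ∧ p ∈ U ∧ SmoothVectorFieldOn v U

/-- `φ` is a smooth scalar field in a neighborhood of `p`. -/
def SmoothScalarFieldNear (n : ℕ) {M : Type*} [TopologicalSpace M]
    [ChartedSpace (EuclideanSpace ℝ (Fin n)) M] (φ : M → ℝ) (p : M) : Prop :=
  ∃ U : Set M, IsOpen U ∧ p ∈ U ∧ ContMDiffOn (𝓡 n) 𝓘(ℝ, ℝ) ∞ φ U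

/-- The directional derivative `∂_a φ` of the scalar field `φ` along the tangent vector `a`
at `p`. -/
def scalarDeriv (p : M) (a : TangentSpace (𝓡 n) p) (φ : M → ℝ) : ℝ :=
  mvfderiv (𝓡 n) φ p a

/-- `D p a u`, for a tangent vector `a` at `p` and a vector field `u` that is smooth in a
neighborhood of `p`, is an affine connection `D_a u`. The values of `D` on other fields play no
role. -/
structure IsAffineConnection
    (D : (p : M) → TangentSpace (𝓡 n) p → ((x : M) → TangentSpace (𝓡 n) x) →
      TangentSpace (𝓡 n) p) : Prop where
  linear_direction (p : M) (a b : TangentSpace (𝓡 n) p) (α β : ℝ)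
    (v : (x : M) → TangentSpace (𝓡 n) x) (hv : SmoothVectorFieldNear v p) :
    D p (α • a + β • b) v = α • D p a v + β • D p b v
  add_field (p : M) (a : TangentSpace (𝓡 n) p) (u v : (x : M) → TangentSpace (𝓡 n) x)
    (hu : SmoothVectorFieldNear u p) (hv : SmoothVectorFieldNear v p) :
    D p a (fun x ↦ u x + v x) = D p a u + D p a v
  product_rule (p : M) (a : TangentSpace (𝓡 n) p) (φ : M → ℝ)
    (v : (x : M) → TangentSpace (𝓡 n) x)
    (hφ : SmoothScalarFieldNear n φ p) (hv : SmoothVectorFieldNear v p) :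
    D p a (fun x ↦ φ x • v x) = scalarDeriv p a φ • v p + φ p • D p a v

/-- `(D_c a) · b + a · (D_c b) = ∂_c (a · b)`. -/
def IsMetricCompatible (g : PseudoRiemannianMetric n M)
    (D : (p : M) → TangentSpace (𝓡 n) p → ((x : M) → TangentSpace (𝓡 n) x) →
      TangentSpace (𝓡 n) p) : Prop :=
  ∀ (p : M) (c : TangentSpace (𝓡 n) p) (a b : (x : M) → TangentSpace (𝓡 n) x),
    SmoothVectorFieldNear a p → SmoothVectorFieldNear b p →
    g.inner p (D p c a) (b p) + g.inner p (a p) (D p c b) =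
      scalarDeriv p c (fun x ↦ g.inner x (a x) (b x))

/-- The connection `D` maps smooth vector fields to smooth vector fields. -/
def PreservesSmoothVectorFields
    (D : (p : M) → TangentSpace (𝓡 n) p → ((x : M) → TangentSpace (𝓡 n) x) →
      TangentSpace (𝓡 n) p) : Prop :=
  ∀ (U : Set M) (a v : (x : M) → TangentSpace (𝓡 n) x), IsOpen U →
    SmoothVectorFieldOn a U → SmoothVectorFieldOn v U →
    SmoothVectorFieldOn (fun x ↦ D x (a x) v) U

/-- `D p a A`, for a tangent vector `a` at `p` and a multivector field `A` that is smooth in a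
neighborhood of `p`, is a multivector directional derivative `D_a A`. The values of `D` on other
fields play no role. -/
structure IsMultivectorDirectionalDerivative (g : PseudoRiemannianMetric n M)
    (D : (p : M) → TangentSpace (𝓡 n) p → ((x : M) → GeomTangentSpace g x) →
      GeomTangentSpace g p) : Prop where
  linear_direction (p : M) (a b : TangentSpace (𝓡 n) p) (α β : ℝ)
    (A : (x : M) → GeomTangentSpace g x) (hA : SmoothMultivectorFieldNear g A p) :
    D p (α • a + β • b) A = α • D p a A + β • D p b A
  scalar_field (p : M) (a : TangentSpace (𝓡 n) p) (φ : M → ℝ)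
    (hφ : SmoothScalarFieldNear n φ p) :
    D p a (fun x ↦ scalarToMultivector g x (φ x)) =
      scalarToMultivector g p (scalarDeriv p a φ)
  vector_field (p : M) (a : TangentSpace (𝓡 n) p) (v : (x : M) → TangentSpace (𝓡 n) x)
    (hv : SmoothVectorFieldNear v p) :
    ∃ w : TangentSpace (𝓡 n) p,
      D p a (fun x ↦ vectorToMultivector g x (v x)) = vectorToMultivector g p w
  add_field (p : M) (a : TangentSpace (𝓡 n) p) (A B : (x : M) → GeomTangentSpace g x)
    (hA : SmoothMultivectorFieldNear g A p) (hB : SmoothMultivectorFieldNear g B p) :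
    D p a (fun x ↦ A x + B x) = D p a A + D p a B
  product_rule (p : M) (a : TangentSpace (𝓡 n) p) (A B : (x : M) → GeomTangentSpace g x)
    (hA : SmoothMultivectorFieldNear g A p) (hB : SmoothMultivectorFieldNear g B p) :
    D p a (fun x ↦ A x * B x) = D p a A * B p + A p * D p a B

/-- The operator `D` maps smooth multivector fields, differentiated along smooth vector fields, to
smooth multivector fields. -/
def PreservesSmoothMultivectorFields (g : PseudoRiemannianMetric n M)
    (D : (p : M) → TangentSpace (𝓡 n) p → ((x : M) → GeomTangentSpace g x) →
      GeomTangentSpace g p) : Prop :=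
  ∀ (U : Set M) (a : (x : M) → TangentSpace (𝓡 n) x) (A : (x : M) → GeomTangentSpace g x),
    IsOpen U → SmoothVectorFieldOn a U → SmoothMultivectorFieldOn g A U →
    SmoothMultivectorFieldOn g (fun x ↦ D x (a x) A) U

end Fields

end

/-! Read in a chart, a multivector field becomes a function with values in the fixed exterior
algebra of `ℝⁿ` (`toExterior`). This identification is linear but does not respect Clifford
products: left multiplication by a vector `v` turns into `v ∧ ·` plus contraction with the linear
form `v · _` (`toExterior_vector_mul`). A connection is given in the chart by `∂_a + ω(a)` with a
matrix `ω(a)` (`chartComponents_connection`). The candidate for `D_a` is `∂_a + L`, where `L` is the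
derivation of the exterior algebra that extends `ω(a)` (`chartDeriv`).

The only hard axiom is the product rule. For `e_i B` with a coordinate vector `e_i`, the wedge part
is the derivation property of `L`. In the contraction part, `L` fails to commute with contraction by
the form `e_i · _` by exactly the contraction with its composite with `ω(a)`
(`derivation_contract`), and metric compatibility says that the derivative of the coefficients `e_i
· e_j` makes up for this (`chartDeriv_coordFrame_mul`). The fields `A` that satisfy the product rule
against every differentiable `B` are closed under sums and products. Near a point every smooth field
is built from scalar fields and coordinate vectors by Clifford sums and products
(`multivectorField_induction`), so the rule holds in general.

The same induction shows that two charts give the same derivative (`chartDeriv_eq`). Smoothness can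
therefore be checked in one fixed chart, where the formula for `D_a A` involves only smooth
coefficients. -/

noncomputable section

/-! ### Derivations and contractions of the exterior algebra. -/

namespace ExteriorAlgebra

variable {R V W : Type*} [CommRing R] [AddCommGroup V] [Module R V] [AddCommGroup W] [Module R W]

/-- The algebra homomorphism `x ↦ x + ε L x` whose infinitesimal part `L` is the derivation of the
exterior algebra that extends the endomorphism `f`. -/
def derivationHom (f : V →ₗ[R] V) :
    ExteriorAlgebra R V →ₐ[R] TrivSqZeroExt (ExteriorAlgebra R V) (ExteriorAlgebra R V) :=
  lift R ⟨(TrivSqZeroExt.inlAlgHom R (ExteriorAlgebra R V) (ExteriorAlgebra R V)).toLinearMap ∘ₗ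
      ι R + (TrivSqZeroExt.inrHom (ExteriorAlgebra R V) (ExteriorAlgebra R V)).restrictScalars R ∘ₗ
        ι R ∘ₗ f, by
    -- The square of `m + ε f m` is `ε (m ∧ f m + f m ∧ m)`, as `ε² = 0`, and this vanishes because
    -- vectors anticommute.
    intro m
    ext
    · simp
    · simp [ι_add_mul_swap]⟩

/-- The derivation of the exterior algebra that extends the endomorphism `f`. -/
def derivation (f : V →ₗ[R] V) : ExteriorAlgebra R V →ₗ[R] ExteriorAlgebra R V :=
  (TrivSqZeroExt.sndHom (ExteriorAlgebra R V) (ExteriorAlgebra R V)).restrictScalars R ∘ₗ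
    (derivationHom f).toLinearMap

/-- Setting `ε = 0` is an algebra homomorphism, and the composite fixes the generators. With this,
multiplicativity of `derivationHom` becomes the product rule for `derivation`. -/
theorem fst_derivationHom (f : V →ₗ[R] V) (x : ExteriorAlgebra R V) :
    (derivationHom f x).fst = x := by
  have h : (TrivSqZeroExt.fstHom R (ExteriorAlgebra R V) (ExteriorAlgebra R V)).comp
      (derivationHom f) = AlgHom.id R _ := by
    apply hom_ext
    ext m
    simp [derivationHom]
  exact congrArg (fun F ↦ F x) h

@[simp]
theorem derivation_ι (f : V →ₗ[R] V) (v : V) : derivation f (ι R v) = ι R (f v) := by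
  simp [derivation, derivationHom]

theorem derivation_mul (f : V →ₗ[R] V) (x y : ExteriorAlgebra R V) :
    derivation f (x * y) = derivation f x * y + x * derivation f y := by
  simp [derivation, fst_derivationHom, add_comm]

@[simp]
theorem derivation_algebraMap (f : V →ₗ[R] V) (r : R) :
    derivation f (algebraMap R _ r) = 0 := by
  simp only [derivation, LinearMap.comp_apply, AlgHom.toLinearMap_apply, AlgHom.commutes]
  simp [TrivSqZeroExt.algebraMap_eq_inl']

@[elab_as_elim]
theorem inductionLeft {P : ExteriorAlgebra R V → Prop} (x : ExteriorAlgebra R V)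
    (algebraMap : ∀ r, P (algebraMap R _ r)) (add : ∀ x y, P x → P y → P (x + y))
    (ι_mul : ∀ x v, P x → P (ι R v * x)) : P x :=
  CliffordAlgebra.left_induction (Q := (0 : QuadraticForm R V)) algebraMap add ι_mul x

theorem derivation_add (f f' : V →ₗ[R] V) (x : ExteriorAlgebra R V) :
    derivation (f + f') x = derivation f x + derivation f' x := by
  induction x using inductionLeft with
  | algebraMap r => simp
  | add x y hx hy => simp only [map_add, hx, hy]; abel
  | ι_mul x v hx => simp only [derivation_mul, derivation_ι, hx, LinearMap.add_apply, map_add,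
      add_mul, mul_add]; abel

theorem derivation_smul (r : R) (f : V →ₗ[R] V) (x : ExteriorAlgebra R V) :
    derivation (r • f) x = r • derivation f x := by
  induction x using inductionLeft with
  | algebraMap r => simp
  | add x y hx hy => simp only [map_add, hx, hy, smul_add]
  | ι_mul x v hx => simp only [derivation_mul, derivation_ι, hx, LinearMap.smul_apply, map_smul,
      smul_mul_assoc, mul_smul_comm, smul_add]

/-- The contraction of an element of the exterior algebra with a linear form. -/
def contract : Module.Dual R V →ₗ[R] ExteriorAlgebra R V →ₗ[R] ExteriorAlgebra R V :=
  CliffordAlgebra.contractLeft (Q := (0 : QuadraticForm R V))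

theorem contract_ι_mul (d : Module.Dual R V) (v : V) (x : ExteriorAlgebra R V) :
    contract d (ι R v * x) = d v • x - ι R v * contract d x :=
  CliffordAlgebra.contractLeft_ι_mul d v x

@[simp]
theorem contract_algebraMap (d : Module.Dual R V) (r : R) :
    contract d (algebraMap R (ExteriorAlgebra R V) r) = 0 :=
  CliffordAlgebra.contractLeft_algebraMap _ d r

@[simp]
theorem contract_one (d : Module.Dual R V) : contract d (1 : ExteriorAlgebra R V) = 0 :=
  CliffordAlgebra.contractLeft_one _ d

/-- The derivation acts on linear forms by `d ↦ -(d ∘ f)`, and contraction is equivariant for this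
action. The last term is the one that metric compatibility has to absorb. -/
theorem derivation_contract (f : V →ₗ[R] V) (d : Module.Dual R V) (x : ExteriorAlgebra R V) :
    derivation f (contract d x) = contract d (derivation f x) - contract (d ∘ₗ f) x := by
  induction x using inductionLeft with
  | algebraMap r => simp
  | add x y hx hy => simp only [map_add, hx, hy]; abel
  | ι_mul x v hx =>
    simp only [derivation_mul, derivation_ι, hx, contract_ι_mul, map_add, map_sub, map_smul,
      mul_sub, LinearMap.comp_apply]
    abel

theorem map_contract (f : V →ₗ[R] W) (d : Module.Dual R W) (x : ExteriorAlgebra R V) :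
    map f (contract (d ∘ₗ f) x) = contract d (map f x) := by
  induction x using inductionLeft with
  | algebraMap r => simp
  | add x y hx hy => simp only [map_add, hx, hy]
  | ι_mul x v hx => simp [contract_ι_mul, hx]

/-- Separates a varying form from the contractions along a fixed basis: for a form that depends on a
point, only the scalar coefficients then have to be differentiated. -/
theorem contract_eq_sum {I : Type*} [Fintype I] (b : Module.Basis I R V) (d : Module.Dual R V)
    (x : ExteriorAlgebra R V) :
    contract d x = ∑ i, d (b i) • contract (b.coord i) x := by
  classical
  have h : d = ∑ i, d (b i) • b.coord i := by
    refine b.ext fun j ↦ ?_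
    simp
  conv_lhs => rw [h]
  simp only [map_sum, map_smul, LinearMap.sum_apply, LinearMap.smul_apply]

theorem map_map_apply {V' : Type*} [AddCommGroup V'] [Module R V'] (f : V →ₗ[R] W)
    (f' : W →ₗ[R] V') (x : ExteriorAlgebra R V) : map f' (map f x) = map (f' ∘ₗ f) x := by
  rw [← map_comp_map]; rfl

end ExteriorAlgebra

/-! ### Clifford multiplication by a vector, seen in the exterior algebra. -/

namespace CliffordAlgebra

variable {R V : Type*} [CommRing R] [Invertible (2 : R)] [AddCommGroup V] [Module R V]

theorem equivExterior_ι_mul (B : LinearMap.BilinForm R V) (hB : ∀ v w, B v w = B w v) (v : V)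
    (x : CliffordAlgebra B.toQuadraticMap) :
    equivExterior B.toQuadraticMap (ι B.toQuadraticMap v * x) =
      ExteriorAlgebra.ι R v * equivExterior B.toQuadraticMap x +
        ExteriorAlgebra.contract (B v) (equivExterior B.toQuadraticMap x) := by
  -- The change of form from `Q` to `0` is made with the bilinear form of `-Q`, and
  -- `changeForm_ι_mul` subtracts its contraction. The two signs cancel, which leaves a plus.
  have h : (QuadraticMap.associated (R := R) (M := V) (-B.toQuadraticMap)) v = -(B v) := by
    have := QuadraticMap.associated_left_inverse (R := R) (S := R) (M := V) (N := R) (B₁ := B)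
      hB
    rw [map_neg, this]; rfl
  simp only [equivExterior, changeFormEquiv_apply]
  refine (changeForm_ι_mul changeForm.associated_neg_proof v x).trans ?_
  rw [congrArg contractLeft h, map_neg contractLeft (B v), LinearMap.neg_apply,
    sub_neg_eq_add]
  rfl

@[simp]
theorem equivExterior_algebraMap (Q : QuadraticForm R V) (r : R) :
    equivExterior Q (algebraMap R _ r) = algebraMap R _ r :=
  changeForm_algebraMap changeForm.associated_neg_proof r

@[simp]
theorem equivExterior_ι (Q : QuadraticForm R V) (v : V) :
    equivExterior Q (ι Q v) = ExteriorAlgebra.ι R v :=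
  changeForm_ι changeForm.associated_neg_proof v

end CliffordAlgebra


/-! ### Derivatives of functions with values in a vector space. -/

section Calculus

variable {E H M F F' : Type*} [NormedAddCommGroup E] [NormedSpace ℝ E] [TopologicalSpace H]
  {I : ModelWithCorners ℝ E H} [TopologicalSpace M] [ChartedSpace H M]
  [NormedAddCommGroup F] [NormedSpace ℝ F] [NormedAddCommGroup F'] [NormedSpace ℝ F']

theorem Filter.EventuallyEq.mvfderiv_eq {f f' : M → F} {p : M} (h : f =ᶠ[𝓝 p] f') :
    mvfderiv I f p = mvfderiv I f' p := by
  ext a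
  simp only [mvfderiv, h.mfderiv_eq, ContinuousLinearMap.comp_apply]
  rfl

theorem mvfderiv_clm_comp (L : F →L[ℝ] F') {f : M → F} {p : M}
    (hf : MDifferentiableAt I 𝓘(ℝ, F) f p) (a : TangentSpace I p) :
    mvfderiv I (fun x ↦ L (f x)) p a = L (mvfderiv I f p a) := by
  have h : mfderiv I 𝓘(ℝ, F') (L ∘ f) p = _ :=
    mfderiv_comp p L.mdifferentiableAt hf
  rw [L.mfderiv_eq] at h
  exact congrArg (fun T ↦ T a) h

theorem MDifferentiableAt.clm_comp_apply (L : F →L[ℝ] F') {f : M → F} {p : M}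
    (hf : MDifferentiableAt I 𝓘(ℝ, F) f p) :
    MDifferentiableAt I 𝓘(ℝ, F') (fun x ↦ L (f x)) p :=
  L.differentiable.comp_mdifferentiableAt hf

theorem mvfderiv_sum {ι : Type*} (s : Finset ι) {f : ι → M → F} {p : M}
    (hf : ∀ i ∈ s, MDifferentiableAt I 𝓘(ℝ, F) (f i) p) :
    MDifferentiableAt I 𝓘(ℝ, F) (fun x ↦ ∑ i ∈ s, f i x) p ∧
    mvfderiv I (fun x ↦ ∑ i ∈ s, f i x) p = ∑ i ∈ s, mvfderiv I (f i) p := by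
  classical
  induction s using Finset.induction_on with
  | empty => simpa using ⟨mdifferentiableAt_const, mvfderiv_const 0⟩
  | insert i s hi ih =>
    obtain ⟨h1, h2⟩ := ih fun j hj ↦ hf j (Finset.mem_insert_of_mem hj)
    have h3 := hf i (Finset.mem_insert_self _ _)
    simp only [Finset.sum_insert hi]
    exact ⟨h3.add h1, by rw [mvfderiv_fun_add h3 h1, h2]⟩

/-- The derivative of a smooth function along a smooth vector field is smooth. -/
theorem ContMDiffOn.mvfderiv_apply [IsManifold I ∞ M] {φ : M → ℝ} {U : Set M} (hU : IsOpen U)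
    (hφ : ContMDiffOn I 𝓘(ℝ, ℝ) ∞ φ U) {a : (x : M) → TangentSpace I x}
    (ha : ContMDiffOn I I.tangent ∞ (fun x ↦ Bundle.TotalSpace.mk' E x (a x)) U) :
    ContMDiffOn I 𝓘(ℝ, ℝ) ∞ (fun x ↦ mvfderiv I φ x (a x)) U := by
  -- The directional derivative is the fibre component of the tangent map of `φ` composed with the
  -- section `a`.
  have h1 : ContMDiffOn I.tangent 𝓘(ℝ, ℝ).tangent ∞ (tangentMapWithin I 𝓘(ℝ, ℝ) φ U)
      (Bundle.TotalSpace.proj ⁻¹' U) :=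
    hφ.contMDiffOn_tangentMapWithin (by simp) hU.uniqueMDiffOn
  have h2 := h1.comp ha fun x hx ↦ hx
  intro x hx
  have h3 := ((Bundle.contMDiffWithinAt_totalSpace.1 (h2 x hx)).2)
  refine h3.congr_of_eventuallyEq ?_ ?_
  · filter_upwards [self_mem_nhdsWithin] with y hy
    simp [tangentMapWithin, mfderivWithin_of_isOpen hU hy, mvfderiv]
    rfl
  · simp [tangentMapWithin, mfderivWithin_of_isOpen hU hx, mvfderiv]
    rfl

end Calculus

/-! ### A norm on the exterior algebra of `ℝⁿ`. -/

section ExteriorNorm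

variable {n : ℕ}

/-- The basis of the exterior algebra of `ℝⁿ` that consists of the wedge products of the standard
basis vectors. -/
def exteriorBasis (n : ℕ) :
    Module.Basis (Finset (Fin n)) ℝ (ExteriorAlgebra ℝ (EuclideanSpace ℝ (Fin n))) :=
  (EuclideanSpace.basisFun (Fin n) ℝ).toBasis.ExteriorAlgebra

/-- The choice of norm is immaterial in finite dimension. It gives a meaning to derivatives, and
every linear map out of this space is continuous. -/
instance : NormedAddCommGroup (ExteriorAlgebra ℝ (EuclideanSpace ℝ (Fin n))) :=
  NormedAddCommGroup.induced _ (Finset (Fin n) → ℝ) (exteriorBasis n).equivFun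
    (exteriorBasis n).equivFun.injective

instance : NormedSpace ℝ (ExteriorAlgebra ℝ (EuclideanSpace ℝ (Fin n))) :=
  NormedSpace.induced ℝ _ (Finset (Fin n) → ℝ) (exteriorBasis n).equivFun.toLinearMap

instance : FiniteDimensional ℝ (ExteriorAlgebra ℝ (EuclideanSpace ℝ (Fin n))) :=
  (exteriorBasis n).finiteDimensional_of_finite

theorem exteriorBasis_apply (J : Finset (Fin n)) :
    exteriorBasis n J = ExteriorAlgebra.ιMulti ℝ J.card
      (fun k ↦ (EuclideanSpace.basisFun (Fin n) ℝ).toBasis (J.orderEmbOfFin rfl k)) := by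
  rw [exteriorBasis, ExteriorAlgebra.basis_apply_ofCard _ rfl]
  rfl

end ExteriorNorm

/-! ### Vectors and multivectors in the components of a chart. -/

section Trivialized

variable {n : ℕ} {M : Type*} [TopologicalSpace M]
  [ChartedSpace (EuclideanSpace ℝ (Fin n)) M] [IsManifold (𝓡 n) ∞ M]

/-- The `i`-th standard basis vector of `ℝⁿ`. -/
abbrev stdBasis (n : ℕ) : Module.Basis (Fin n) ℝ (EuclideanSpace ℝ (Fin n)) :=
  (EuclideanSpace.basisFun (Fin n) ℝ).toBasis

/-- The components of a tangent vector at `x` in the chart at `x₀`. -/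
def chartComponents (x₀ x : M) : TangentSpace (𝓡 n) x →ₗ[ℝ] EuclideanSpace ℝ (Fin n) :=
  (trivializationAt (EuclideanSpace ℝ (Fin n)) (TangentSpace (𝓡 n)) x₀).linearMapAt ℝ x

/-- The tangent vector at `x` with given components in the chart at `x₀`. -/
def ofChartComponents (x₀ x : M) : EuclideanSpace ℝ (Fin n) →ₗ[ℝ] TangentSpace (𝓡 n) x :=
  (trivializationAt (EuclideanSpace ℝ (Fin n)) (TangentSpace (𝓡 n)) x₀).symmₗ ℝ x

variable {x₀ x : M}

theorem chartComponents_ofChartComponents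
    (hx : x ∈ (chartAt (EuclideanSpace ℝ (Fin n)) x₀).source) (v : EuclideanSpace ℝ (Fin n)) :
    chartComponents x₀ x (ofChartComponents x₀ x v) = v :=
  Bundle.Trivialization.linearMapAt_symmₗ _ hx v

theorem ofChartComponents_chartComponents
    (hx : x ∈ (chartAt (EuclideanSpace ℝ (Fin n)) x₀).source) (v : TangentSpace (𝓡 n) x) :
    ofChartComponents x₀ x (chartComponents x₀ x v) = v :=
  Bundle.Trivialization.symmₗ_linearMapAt _ hx v

theorem coordFrame_eq (hx : x ∈ (chartAt (EuclideanSpace ℝ (Fin n)) x₀).source) (i : Fin n) :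
    coordFrame x₀ i x = ofChartComponents x₀ x (stdBasis n i) := by
  have hx' : x ∈ (trivializationAt (EuclideanSpace ℝ (Fin n)) (TangentSpace (𝓡 n)) x₀).baseSet := hx
  rw [coordFrame, Bundle.Trivialization.localFrame_apply_of_mem_baseSet _ _ hx',
    Bundle.Trivialization.basisAt, Module.Basis.map_apply,
    Bundle.Trivialization.linearEquivAt_symm_apply]
  exact (congrFun (Bundle.Trivialization.coe_symmₗ _ hx') _).symm

theorem chartComponents_coordFrame (hx : x ∈ (chartAt (EuclideanSpace ℝ (Fin n)) x₀).source)
    (i : Fin n) : chartComponents x₀ x (coordFrame x₀ i x) = stdBasis n i := by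
  rw [coordFrame_eq hx, chartComponents_ofChartComponents hx]

theorem eq_sum_coordFrame (hx : x ∈ (chartAt (EuclideanSpace ℝ (Fin n)) x₀).source)
    (v : TangentSpace (𝓡 n) x) :
    v = ∑ i, (stdBasis n).repr (chartComponents x₀ x v) i • coordFrame x₀ i x := by
  conv_lhs => rw [← ofChartComponents_chartComponents hx v,
    ← (stdBasis n).sum_repr (chartComponents x₀ x v)]
  simp only [map_sum, map_smul, coordFrame_eq hx]

theorem smoothVectorFieldOn_coordFrame (x₀ : M) (i : Fin n) :
    SmoothVectorFieldOn (coordFrame x₀ i) (chartAt (EuclideanSpace ℝ (Fin n)) x₀).source :=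
  Bundle.Trivialization.contMDiffOn_localFrame_baseSet ∞
    (trivializationAt (EuclideanSpace ℝ (Fin n)) (TangentSpace (𝓡 n)) x₀) _ i

theorem smoothVectorFieldNear_coordFrame
    (hx : x ∈ (chartAt (EuclideanSpace ℝ (Fin n)) x₀).source) (i : Fin n) :
    SmoothVectorFieldNear (coordFrame x₀ i) x :=
  ⟨_, (chartAt _ x₀).open_source, hx, smoothVectorFieldOn_coordFrame x₀ i⟩

/-- The components of a smooth vector field are smooth. -/
theorem SmoothVectorFieldOn.chartComponents {v : (x : M) → TangentSpace (𝓡 n) x} {U : Set M}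
    (hU : IsOpen U) (hU' : U ⊆ (chartAt (EuclideanSpace ℝ (Fin n)) x₀).source)
    (hv : SmoothVectorFieldOn v U) :
    ContMDiffOn (𝓡 n) 𝓘(ℝ, EuclideanSpace ℝ (Fin n)) ∞ (fun x ↦ chartComponents x₀ x (v x)) U := by
  refine ((Bundle.Trivialization.contMDiffOn_section_iff (trivializationAt
    (EuclideanSpace ℝ (Fin n)) (TangentSpace (𝓡 n)) x₀) hU hU').1 hv).congr fun x hx ↦ ?_
  exact Bundle.Trivialization.linearMapAt_apply _ _ |>.trans (if_pos (hU' hx))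

theorem SmoothVectorFieldNear.chartComponents {v : (x : M) → TangentSpace (𝓡 n) x}
    (hx : x ∈ (chartAt (EuclideanSpace ℝ (Fin n)) x₀).source) (hv : SmoothVectorFieldNear v x) :
    ∃ U : Set M, IsOpen U ∧ x ∈ U ∧ U ⊆ (chartAt (EuclideanSpace ℝ (Fin n)) x₀).source ∧
      ContMDiffOn (𝓡 n) 𝓘(ℝ, EuclideanSpace ℝ (Fin n)) ∞
        (fun x ↦ _root_.chartComponents x₀ x (v x)) U := by
  obtain ⟨U, hU, hxU, hv⟩ := hv
  have ho := hU.inter (chartAt (EuclideanSpace ℝ (Fin n)) x₀).open_source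
  exact ⟨_, ho, ⟨hxU, hx⟩, Set.inter_subset_right,
    SmoothVectorFieldOn.chartComponents ho Set.inter_subset_right (hv.mono Set.inter_subset_left)⟩

variable (g : PseudoRiemannianMetric n M)

theorem SmoothVectorFieldOn.inner {u v : (x : M) → TangentSpace (𝓡 n) x} {U : Set M}
    (hu : SmoothVectorFieldOn u U) (hv : SmoothVectorFieldOn v U) :
    ContMDiffOn (𝓡 n) 𝓘(ℝ, ℝ) ∞ (fun x ↦ g.inner x (u x) (v x)) U := by
  have h := ContMDiffOn.clm_bundle_apply₂ (F₁ := EuclideanSpace ℝ (Fin n))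
    (F₂ := EuclideanSpace ℝ (Fin n)) (F₃ := ℝ) (E₃ := Bundle.Trivial M ℝ) (b := fun x ↦ x)
    (ψ := g.inner) (g.contMDiff.contMDiffOn (s := U)) hu hv
  intro x hx
  exact (Bundle.contMDiffWithinAt_totalSpace.1 (h x hx)).2

/-- A tangent multivector at `x`, as an element of the exterior algebra of `ℝⁿ`, by means of the
chart at `x₀`. -/
def toExterior (x₀ x : M) :
    GeomTangentSpace g x →ₗ[ℝ] ExteriorAlgebra ℝ (EuclideanSpace ℝ (Fin n)) :=
  (ExteriorAlgebra.map (chartComponents x₀ x)).toLinearMap ∘ₗ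
    (CliffordAlgebra.equivExterior (g.quadraticForm x)).toLinearMap

/-- The tangent multivector at `x` that belongs to an element of the exterior algebra of `ℝⁿ`, by
means of the chart at `x₀`. -/
def ofExterior (x₀ x : M) :
    ExteriorAlgebra ℝ (EuclideanSpace ℝ (Fin n)) →ₗ[ℝ] GeomTangentSpace g x :=
  (CliffordAlgebra.equivExterior (g.quadraticForm x)).symm.toLinearMap ∘ₗ
    (ExteriorAlgebra.map (ofChartComponents x₀ x)).toLinearMap

theorem toExterior_ofExterior (hx : x ∈ (chartAt (EuclideanSpace ℝ (Fin n)) x₀).source)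
    (y : ExteriorAlgebra ℝ (EuclideanSpace ℝ (Fin n))) :
    toExterior g x₀ x (ofExterior g x₀ x y) = y := by
  have h : chartComponents x₀ x ∘ₗ ofChartComponents x₀ x = LinearMap.id :=
    LinearMap.ext (chartComponents_ofChartComponents hx)
  simp only [toExterior, ofExterior, LinearMap.comp_apply, LinearEquiv.coe_coe,
    LinearEquiv.apply_symm_apply, AlgHom.toLinearMap_apply]
  rw [ExteriorAlgebra.map_map_apply, h, ExteriorAlgebra.map_id]
  rfl

theorem ofExterior_toExterior (hx : x ∈ (chartAt (EuclideanSpace ℝ (Fin n)) x₀).source)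
    (A : GeomTangentSpace g x) : ofExterior g x₀ x (toExterior g x₀ x A) = A := by
  have h : ofChartComponents x₀ x ∘ₗ chartComponents x₀ x = LinearMap.id :=
    LinearMap.ext (ofChartComponents_chartComponents hx)
  simp only [toExterior, ofExterior, LinearMap.comp_apply, LinearEquiv.coe_coe,
    AlgHom.toLinearMap_apply]
  rw [ExteriorAlgebra.map_map_apply, h, ExteriorAlgebra.map_id]
  exact LinearEquiv.symm_apply_apply _ _

theorem multivectorCoordFrame_eq (hx : x ∈ (chartAt (EuclideanSpace ℝ (Fin n)) x₀).source)
    (J : Finset (Fin n)) :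
    multivectorCoordFrame g x₀ J x = ofExterior g x₀ x (exteriorBasis n J) := by
  simp only [multivectorCoordFrame, wedgeVectors, ofExterior, LinearMap.comp_apply,
    LinearEquiv.coe_coe, AlgHom.toLinearMap_apply, exteriorBasis_apply, coordFrame_eq hx,
    ExteriorAlgebra.map_apply_ιMulti]
  rfl

theorem toExterior_scalar (r : ℝ) :
    toExterior g x₀ x (scalarToMultivector g x r) = algebraMap ℝ _ r := by
  simp only [toExterior, scalarToMultivector, LinearMap.comp_apply, LinearEquiv.coe_coe,
    Algebra.ofId_apply, CliffordAlgebra.equivExterior_algebraMap, AlgHom.toLinearMap_apply,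
    AlgHom.commutes]

theorem toExterior_vector (v : TangentSpace (𝓡 n) x) :
    toExterior g x₀ x (vectorToMultivector g x v) =
      ExteriorAlgebra.ι ℝ (chartComponents x₀ x v) := by
  simp only [toExterior, vectorToMultivector, LinearMap.comp_apply, LinearEquiv.coe_coe,
    CliffordAlgebra.equivExterior_ι, AlgHom.toLinearMap_apply, ExteriorAlgebra.map_apply_ι]

/-- The linear form `w ↦ v · w`, in the components of the chart at `x₀`. -/
def lowerIndex (x₀ x : M) (v : TangentSpace (𝓡 n) x) :
    Module.Dual ℝ (EuclideanSpace ℝ (Fin n)) :=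
  (g.inner x v).toLinearMap ∘ₗ ofChartComponents x₀ x

theorem equivExterior_vector_mul (v : TangentSpace (𝓡 n) x) (A : GeomTangentSpace g x) :
    CliffordAlgebra.equivExterior (g.quadraticForm x) (vectorToMultivector g x v * A) =
      ExteriorAlgebra.ι ℝ v * CliffordAlgebra.equivExterior (g.quadraticForm x) A +
      ExteriorAlgebra.contract (g.inner x v).toLinearMap
        (CliffordAlgebra.equivExterior (g.quadraticForm x) A) :=
  CliffordAlgebra.equivExterior_ι_mul (g.inner x).toBilinForm (g.symm x) v A

/-- Contraction is natural under the linear map given by the chart, so the formula for Clifford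
multiplication keeps its shape, with the metric entering only through `lowerIndex`. -/
theorem toExterior_vector_mul (hx : x ∈ (chartAt (EuclideanSpace ℝ (Fin n)) x₀).source)
    (v : TangentSpace (𝓡 n) x) (A : GeomTangentSpace g x) :
    toExterior g x₀ x (vectorToMultivector g x v * A) =
      ExteriorAlgebra.ι ℝ (chartComponents x₀ x v) * toExterior g x₀ x A +
      ExteriorAlgebra.contract (lowerIndex g x₀ x v) (toExterior g x₀ x A) := by
  have h : (g.inner x v).toLinearMap = lowerIndex g x₀ x v ∘ₗ chartComponents x₀ x := by
    ext w
    simp [lowerIndex, ofChartComponents_chartComponents hx]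
  simp only [toExterior, LinearMap.comp_apply, LinearEquiv.coe_coe, AlgHom.toLinearMap_apply]
  rw [equivExterior_vector_mul, map_add, map_mul, ExteriorAlgebra.map_apply_ι, h,
    ExteriorAlgebra.map_contract]

end Trivialized

theorem eventually_mem_chartSource {n : ℕ} {M : Type*} [TopologicalSpace M]
    [ChartedSpace (EuclideanSpace ℝ (Fin n)) M] {x₀ p : M}
    (hp : p ∈ (chartAt (EuclideanSpace ℝ (Fin n)) x₀).source) :
    ∀ᶠ x in 𝓝 p, x ∈ (chartAt (EuclideanSpace ℝ (Fin n)) x₀).source :=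
  (chartAt _ x₀).open_source.mem_nhds hp

/-! ### Generation of multivector fields by scalars and coordinate vectors. -/

section Induction

variable {n : ℕ} {M : Type*} [TopologicalSpace M]
  [ChartedSpace (EuclideanSpace ℝ (Fin n)) M] [IsManifold (𝓡 n) ∞ M]
  (g : PseudoRiemannianMetric n M) {x₀ p : M}

theorem toExterior_injective {x : M} (hx : x ∈ (chartAt (EuclideanSpace ℝ (Fin n)) x₀).source) :
    Function.Injective (toExterior g x₀ x) :=
  Function.LeftInverse.injective (ofExterior_toExterior g hx)

theorem scalarToMultivector_mul (x : M) (r : ℝ) (A : GeomTangentSpace g x) :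
    scalarToMultivector g x r * A = r • A :=
  (Algebra.smul_def r A).symm

theorem ofExterior_ι_mul {x : M} (hx : x ∈ (chartAt (EuclideanSpace ℝ (Fin n)) x₀).source)
    (i : Fin n) (y : ExteriorAlgebra ℝ (EuclideanSpace ℝ (Fin n))) :
    ofExterior g x₀ x (ExteriorAlgebra.ι ℝ (stdBasis n i) * y) =
      vectorToMultivector g x (coordFrame x₀ i x) * ofExterior g x₀ x y -
        ofExterior g x₀ x
          (ExteriorAlgebra.contract (lowerIndex g x₀ x (coordFrame x₀ i x)) y) := by
  apply toExterior_injective g hx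
  rw [map_sub, toExterior_vector_mul g hx]
  simp only [toExterior_ofExterior g hx, chartComponents_coordFrame hx, add_sub_cancel_right]

theorem lowerIndex_coordFrame {x : M} (hx : x ∈ (chartAt (EuclideanSpace ℝ (Fin n)) x₀).source)
    (v : TangentSpace (𝓡 n) x) (j : Fin n) :
    lowerIndex g x₀ x v (stdBasis n j) = g.inner x v (coordFrame x₀ j x) := by
  rw [coordFrame_eq hx]; rfl

theorem smoothScalarFieldNear_inner {u v : (x : M) → TangentSpace (𝓡 n) x}
    (hu : SmoothVectorFieldNear u p) (hv : SmoothVectorFieldNear v p) :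
    SmoothScalarFieldNear n (fun x ↦ g.inner x (u x) (v x)) p := by
  obtain ⟨U, hU, hpU, hu⟩ := hu
  obtain ⟨V, hV, hpV, hv⟩ := hv
  exact ⟨U ∩ V, hU.inter hV, ⟨hpU, hpV⟩, SmoothVectorFieldOn.inner g
    (hu.mono Set.inter_subset_left) (hv.mono Set.inter_subset_right)⟩

/-- A local property of multivector fields that holds for scalar fields and for coordinate vector
fields and that is closed under sums and products holds for all smooth multivector fields. -/
theorem multivectorField_induction (hp : p ∈ (chartAt (EuclideanSpace ℝ (Fin n)) x₀).source)
    {P : ((x : M) → GeomTangentSpace g x) → Prop}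
    (congr : ∀ A B, (∀ᶠ x in 𝓝 p, A x = B x) → P A → P B)
    (scalar : ∀ φ, SmoothScalarFieldNear n φ p → P (fun x ↦ scalarToMultivector g x (φ x)))
    (vector : ∀ i, P (fun x ↦ vectorToMultivector g x (coordFrame x₀ i x)))
    (add : ∀ A B, P A → P B → P (fun x ↦ A x + B x))
    (mul : ∀ A B, P A → P B → P (fun x ↦ A x * B x))
    (A : (x : M) → GeomTangentSpace g x) (hA : SmoothMultivectorFieldNear g A p) : P A := by
  have hsource := eventually_mem_chartSource hp
  have const (r : ℝ) : SmoothScalarFieldNear n (fun _ : M ↦ r) p :=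
    ⟨Set.univ, isOpen_univ, trivial, contMDiffOn_const⟩
  have smul (φ : M → ℝ) (hφ : SmoothScalarFieldNear n φ p) (A) (hA : P A) :
      P (fun x ↦ φ x • A x) := by
    simpa only [scalarToMultivector_mul] using mul _ _ (scalar φ hφ) hA
  have sub (A B) (hA : P A) (hB : P B) : P (fun x ↦ A x - B x) := by
    simpa only [neg_smul, one_smul, ← sub_eq_add_neg] using add _ _ hA (smul _ (const (-1)) _ hB)
  have zero : P (fun x ↦ 0) := by
    simpa only [map_zero] using scalar _ (const 0)
  let w (l : List (Fin n)) : ExteriorAlgebra ℝ (EuclideanSpace ℝ (Fin n)) :=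
    (l.map fun i ↦ ExteriorAlgebra.ι ℝ (stdBasis n i)).prod
  -- Contraction moves through a wedge product one factor at a time. The factors already passed are
  -- collected in `pre`, and each resulting term has lost one factor, so a total length of `k + 1`
  -- is reduced to products of length at most `k`.
  have contr (k : ℕ) (ih : ∀ l : List (Fin n), l.length ≤ k → P (fun x ↦ ofExterior g x₀ x (w l)))
      (i : Fin n) : ∀ l pre : List (Fin n), pre.length + l.length ≤ k + 1 →
      P (fun x ↦ ofExterior g x₀ x (w pre * ExteriorAlgebra.contract
        (lowerIndex g x₀ x (coordFrame x₀ i x)) (w l))) := by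
    intro l
    induction l with
    | nil =>
      intro pre _
      simpa [w] using zero
    | cons j l ihl =>
      intro pre hle
      simp only [List.length_cons] at hle
      -- Contraction either hits `e_j`, which yields the smooth coefficient `e_i · e_j` and removes
      -- `e_j`, or passes it with a sign, which moves `e_j` to `pre`.
      refine congr _ _ ?_ (sub _ _
        (smul _ (smoothScalarFieldNear_inner g (smoothVectorFieldNear_coordFrame hp i)
          (smoothVectorFieldNear_coordFrame hp j)) _
          (ih (pre ++ l) (by simp only [List.length_append]; omega)))
        (ihl (pre ++ [j]) (by simp only [List.length_append, List.length_singleton]; omega)))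
      filter_upwards [hsource] with x hx
      simp only [w, List.map_append, List.prod_append, List.map_cons, List.prod_cons,
        List.map_nil, List.prod_nil, mul_one, ExteriorAlgebra.contract_ι_mul, mul_sub, map_sub,
        mul_smul_comm, map_smul, lowerIndex_coordFrame g hx, mul_assoc]
  have list (k : ℕ) : ∀ l : List (Fin n), l.length ≤ k → P (fun x ↦ ofExterior g x₀ x (w l)) := by
    induction k with
    | zero =>
      intro l hl
      obtain rfl : l = [] := List.length_eq_zero_iff.1 (by omega)
      refine congr _ _ ?_ (scalar _ (const 1))
      filter_upwards [hsource] with x hx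
      apply toExterior_injective g hx
      rw [toExterior_ofExterior g hx, toExterior_scalar]
      simp [w]
    | succ k ih =>
      intro l hl
      cases l with
      | nil => exact ih [] (by simp)
      | cons i l =>
        simp only [List.length_cons] at hl
        -- A wedge product is a Clifford product minus a contraction: `e_i ∧ y = e_i y - e_i ⌟ y`,
        -- where both terms on the right come from shorter wedge products.
        refine congr _ _ ?_ (sub _ _ (mul _ _ (vector i) (ih l (by omega)))
          (contr k ih i l [] (by simp only [List.length_nil]; omega)))
        filter_upwards [hsource] with x hx
        simp only [w, List.map_cons, List.prod_cons, List.map_nil, List.prod_nil, one_mul]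
        rw [ofExterior_ι_mul g hx]
  have frame (J : Finset (Fin n)) : P (multivectorCoordFrame g x₀ J) := by
    refine congr _ _ ?_ (list _ (List.ofFn fun k ↦ J.orderEmbOfFin rfl k) le_rfl)
    filter_upwards [hsource] with x hx
    rw [multivectorCoordFrame_eq g hx, exteriorBasis_apply, ExteriorAlgebra.ιMulti_apply]
    simp only [w, List.map_ofFn]
    rfl
  have sum (s : Finset (Finset (Fin n))) (c : Finset (Fin n) → M → ℝ)
      (hc : ∀ J, SmoothScalarFieldNear n (c J) p) :
      P (fun x ↦ ∑ J ∈ s, c J x • multivectorCoordFrame g x₀ J x) := by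
    classical
    induction s using Finset.induction_on with
    | empty => simpa using zero
    | insert J s hJ ih =>
      simp only [Finset.sum_insert hJ]
      exact add _ _ (smul _ (hc J) _ (frame J)) ih
  obtain ⟨U, hU, hpU, hA⟩ := hA
  obtain ⟨c, hc, hAc⟩ := hA x₀
  have ho := hU.inter (chartAt (EuclideanSpace ℝ (Fin n)) x₀).open_source
  refine congr _ _ ?_ (sum Finset.univ c fun J ↦ ⟨_, ho, ⟨hpU, hp⟩, hc J⟩)
  filter_upwards [ho.mem_nhds ⟨hpU, hp⟩] with x hx
  exact (hAc x hx).symm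

end Induction

/-! ### Locality and connection form of an affine connection. -/

section AffineConnection

variable {n : ℕ} {M : Type*} [TopologicalSpace M]
  [ChartedSpace (EuclideanSpace ℝ (Fin n)) M] [IsManifold (𝓡 n) ∞ M] {x₀ p : M}

theorem SmoothVectorFieldNear.congr {u v : (x : M) → TangentSpace (𝓡 n) x}
    (hu : SmoothVectorFieldNear u p) (h : ∀ᶠ x in 𝓝 p, u x = v x) :
    SmoothVectorFieldNear v p := by
  obtain ⟨U, hU, hpU, hu⟩ := hu
  obtain ⟨V, hV, hVo, hpV⟩ := eventually_nhds_iff.1 h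
  refine ⟨U ∩ V, hU.inter hVo, ⟨hpU, hpV⟩, ContMDiffOn.congr (hu.mono Set.inter_subset_left) ?_⟩
  intro x hx
  rw [hV x hx.2]

theorem SmoothVectorFieldNear.add {u v : (x : M) → TangentSpace (𝓡 n) x}
    (hu : SmoothVectorFieldNear u p) (hv : SmoothVectorFieldNear v p) :
    SmoothVectorFieldNear (fun x ↦ u x + v x) p := by
  obtain ⟨U, hU, hpU, hu⟩ := hu
  obtain ⟨V, hV, hpV, hv⟩ := hv
  exact ⟨U ∩ V, hU.inter hV, ⟨hpU, hpV⟩, ContMDiffOn.add_section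
    (hu.mono Set.inter_subset_left) (hv.mono Set.inter_subset_right)⟩

theorem SmoothVectorFieldNear.smul {φ : M → ℝ} {v : (x : M) → TangentSpace (𝓡 n) x}
    (hφ : SmoothScalarFieldNear n φ p) (hv : SmoothVectorFieldNear v p) :
    SmoothVectorFieldNear (fun x ↦ φ x • v x) p := by
  obtain ⟨U, hU, hpU, hφ⟩ := hφ
  obtain ⟨V, hV, hpV, hv⟩ := hv
  exact ⟨U ∩ V, hU.inter hV, ⟨hpU, hpV⟩, ContMDiffOn.smul_section
    (hφ.mono Set.inter_subset_left) (hv.mono Set.inter_subset_right)⟩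

theorem smoothVectorFieldNear_zero :
    SmoothVectorFieldNear (fun _ ↦ 0 : (x : M) → TangentSpace (𝓡 n) x) p :=
  ⟨Set.univ, isOpen_univ, trivial,
    (Bundle.contMDiff_zeroSection ℝ (TangentSpace (𝓡 n) : M → Type _)).contMDiffOn⟩

variable {D' : (p : M) → TangentSpace (𝓡 n) p → ((x : M) → TangentSpace (𝓡 n) x) →
      TangentSpace (𝓡 n) p}

/-- An affine connection is a local operator. -/
theorem IsAffineConnection.congr (hD' : IsAffineConnection D') (a : TangentSpace (𝓡 n) p)
    {u v : (x : M) → TangentSpace (𝓡 n) x}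
    (hu : SmoothVectorFieldNear u p) (h : ∀ᶠ x in 𝓝 p, u x = v x) : D' p a u = D' p a v := by
  classical
  -- No bump function is needed: the product rule asks for smoothness of `φ` only near `p`, where it
  -- is constantly `1`, and `φ u = φ v` holds on all of `M`.
  let φ : M → ℝ := fun x ↦ if u x = v x then 1 else 0
  have h1 : φ =ᶠ[𝓝 p] fun _ ↦ 1 := by
    filter_upwards [h] with x hx
    simp [φ, hx]
  have hφ : SmoothScalarFieldNear n φ p := by
    obtain ⟨V, hV, hVo, hpV⟩ := eventually_nhds_iff.1 h
    exact ⟨V, hVo, hpV, contMDiffOn_const.congr fun x hx ↦ if_pos (hV x hx)⟩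
  have hd : scalarDeriv p a φ = 0 := by
    rw [scalarDeriv, h1.mvfderiv_eq, mvfderiv_const]; rfl
  have huv : (fun x ↦ φ x • u x) = fun x ↦ φ x • v x := by
    funext x
    by_cases hx : u x = v x <;> simp [φ, hx]
  have hu' := hD'.product_rule p a φ u hφ hu
  have hv' := hD'.product_rule p a φ v hφ (hu.congr h)
  rw [huv, hv'] at hu'
  simpa [hd, h1.eq_of_nhds] using hu'.symm

theorem IsAffineConnection.sum (hD' : IsAffineConnection D') (a : TangentSpace (𝓡 n) p)
    {ι : Type*} (s : Finset ι) {v : ι → (x : M) → TangentSpace (𝓡 n) x}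
    (hv : ∀ i, SmoothVectorFieldNear (v i) p) :
    SmoothVectorFieldNear (fun x ↦ ∑ i ∈ s, v i x) p ∧
      D' p a (fun x ↦ ∑ i ∈ s, v i x) = ∑ i ∈ s, D' p a (v i) := by
  classical
  induction s using Finset.induction_on with
  | empty =>
    have h := hD'.add_field p a _ _ smoothVectorFieldNear_zero smoothVectorFieldNear_zero
    simp only [add_zero, left_eq_add] at h
    simpa only [Finset.sum_empty] using ⟨smoothVectorFieldNear_zero, h⟩
  | insert i s hi ih =>
    simp only [Finset.sum_insert hi]
    exact ⟨(hv i).add ih.1, by rw [hD'.add_field p a _ _ (hv i) ih.1, ih.2]⟩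

variable (D') in
/-- The connection form of an affine connection along `a`, in the chart at `x₀`. -/
def connectionForm (x₀ p : M) (a : TangentSpace (𝓡 n) p) :
    EuclideanSpace ℝ (Fin n) →ₗ[ℝ] EuclideanSpace ℝ (Fin n) :=
  (stdBasis n).constr ℝ fun i ↦ chartComponents x₀ p (D' p a (coordFrame x₀ i))

theorem connectionForm_stdBasis (a : TangentSpace (𝓡 n) p) (i : Fin n) :
    connectionForm D' x₀ p a (stdBasis n i) = chartComponents x₀ p (D' p a (coordFrame x₀ i)) :=
  Module.Basis.constr_basis _ _ _ _

theorem connectionForm_linear (hD' : IsAffineConnection D')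
    (hp : p ∈ (chartAt (EuclideanSpace ℝ (Fin n)) x₀).source)
    (a b : TangentSpace (𝓡 n) p) (α β : ℝ) :
    connectionForm D' x₀ p (α • a + β • b) =
      α • connectionForm D' x₀ p a + β • connectionForm D' x₀ p b := by
  refine (stdBasis n).ext fun i ↦ ?_
  simp only [LinearMap.add_apply, LinearMap.smul_apply, connectionForm_stdBasis,
    hD'.linear_direction p a b α β _ (smoothVectorFieldNear_coordFrame hp i), map_add, map_smul]

/-- The components of the derivative of a vector field. -/
theorem chartComponents_connection (hD' : IsAffineConnection D')
    (hp : p ∈ (chartAt (EuclideanSpace ℝ (Fin n)) x₀).source)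
    (a : TangentSpace (𝓡 n) p) {v : (x : M) → TangentSpace (𝓡 n) x}
    (hv : SmoothVectorFieldNear v p) :
    chartComponents x₀ p (D' p a v) =
      mvfderiv (𝓡 n) (fun x ↦ chartComponents x₀ x (v x)) p a +
        connectionForm D' x₀ p a (chartComponents x₀ p (v p)) := by
  obtain ⟨U, hU, hpU, hUs, hs⟩ := hv.chartComponents hp
  let ℓ (i : Fin n) : EuclideanSpace ℝ (Fin n) →L[ℝ] ℝ :=
    LinearMap.toContinuousLinearMap ((stdBasis n).coord i)
  have hφ (i : Fin n) : SmoothScalarFieldNear n (fun x ↦ ℓ i (chartComponents x₀ x (v x))) p :=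
    ⟨U, hU, hpU, (ℓ i).contMDiff.comp_contMDiffOn hs⟩
  have hd : MDifferentiableAt (𝓡 n) 𝓘(ℝ, EuclideanSpace ℝ (Fin n))
      (fun x ↦ chartComponents x₀ x (v x)) p :=
    (hs.contMDiffAt (hU.mem_nhds hpU)).mdifferentiableAt (by simp)
  have he (i : Fin n) := smoothVectorFieldNear_coordFrame hp i
  -- The expansion in the coordinate frame is valid only on the chart domain, so locality is needed
  -- to differentiate it.
  have h1 : D' p a v =
      D' p a (fun x ↦ ∑ i, ℓ i (chartComponents x₀ x (v x)) • coordFrame x₀ i x) := by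
    apply hD'.congr a hv
    filter_upwards [eventually_mem_chartSource hp] with x hx using eq_sum_coordFrame hx (v x)
  rw [h1, (hD'.sum a Finset.univ fun i ↦ (he i).smul (hφ i)).2]
  simp only [map_sum, hD'.product_rule p a _ _ (hφ _) (he _), map_add, map_smul,
    chartComponents_coordFrame hp, Finset.sum_add_distrib, ← connectionForm_stdBasis]
  congr 1
  · simp only [scalarDeriv, mvfderiv_clm_comp _ hd]
    exact (stdBasis n).sum_repr _
  · simp only [← map_smul, ← map_sum]
    congr 1
    exact (stdBasis n).sum_repr _

end AffineConnection

theorem SmoothScalarFieldNear.mdifferentiableAt {n : ℕ} {M : Type*} [TopologicalSpace M]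
    [ChartedSpace (EuclideanSpace ℝ (Fin n)) M] {φ : M → ℝ} {p : M}
    (hφ : SmoothScalarFieldNear n φ p) : MDifferentiableAt (𝓡 n) 𝓘(ℝ, ℝ) φ p := by
  obtain ⟨U, hU, hpU, hφ⟩ := hφ
  exact (hφ.contMDiffAt (hU.mem_nhds hpU)).mdifferentiableAt (by simp)

/-! ### The multivector derivative in a chart. -/

section MultivectorDerivative

variable {n : ℕ} {M : Type*} [TopologicalSpace M]
  [ChartedSpace (EuclideanSpace ℝ (Fin n)) M] [IsManifold (𝓡 n) ∞ M]
  (g : PseudoRiemannianMetric n M)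
  (D' : (p : M) → TangentSpace (𝓡 n) p → ((x : M) → TangentSpace (𝓡 n) x) →
      TangentSpace (𝓡 n) p)

/-- The multivector field `A`, read in the chart at `x₀`, is differentiable at `p`. -/
def ChartDifferentiableAt (x₀ : M) (A : (x : M) → GeomTangentSpace g x) (p : M) : Prop :=
  MDifferentiableAt (𝓡 n) 𝓘(ℝ, ExteriorAlgebra ℝ (EuclideanSpace ℝ (Fin n)))
    (fun x ↦ toExterior g x₀ x (A x)) p

/-- The directional derivative of a multivector field that the affine connection `D'` induces,
computed in the chart at `x₀`. -/
def chartDeriv (x₀ p : M) (a : TangentSpace (𝓡 n) p) (A : (x : M) → GeomTangentSpace g x) :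
    GeomTangentSpace g p :=
  ofExterior g x₀ p (mvfderiv (𝓡 n) (fun x ↦ toExterior g x₀ x (A x)) p a +
    ExteriorAlgebra.derivation (connectionForm D' x₀ p a) (toExterior g x₀ p (A p)))

variable {g D'} {x₀ p : M}

theorem toExterior_chartDeriv (hp : p ∈ (chartAt (EuclideanSpace ℝ (Fin n)) x₀).source)
    (a : TangentSpace (𝓡 n) p) (A : (x : M) → GeomTangentSpace g x) :
    toExterior g x₀ p (chartDeriv g D' x₀ p a A) =
      mvfderiv (𝓡 n) (fun x ↦ toExterior g x₀ x (A x)) p a +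
        ExteriorAlgebra.derivation (connectionForm D' x₀ p a) (toExterior g x₀ p (A p)) :=
  toExterior_ofExterior g hp _

theorem ChartDifferentiableAt.congr {A B : (x : M) → GeomTangentSpace g x}
    (hA : ChartDifferentiableAt g x₀ A p) (h : ∀ᶠ x in 𝓝 p, A x = B x) :
    ChartDifferentiableAt g x₀ B p :=
  MDifferentiableAt.congr_of_eventuallyEq hA (h.mono fun x hx ↦ congrArg (toExterior g x₀ x) hx.symm)

theorem chartDeriv_congr (a : TangentSpace (𝓡 n) p) {A B : (x : M) → GeomTangentSpace g x}
    (h : ∀ᶠ x in 𝓝 p, A x = B x) : chartDeriv g D' x₀ p a A = chartDeriv g D' x₀ p a B := by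
  have h' : (fun x ↦ toExterior g x₀ x (A x)) =ᶠ[𝓝 p] fun x ↦ toExterior g x₀ x (B x) :=
    h.mono fun x hx ↦ congrArg (toExterior g x₀ x) hx
  rw [chartDeriv, chartDeriv, h'.mvfderiv_eq, h.self_of_nhds]

theorem ChartDifferentiableAt.add {A B : (x : M) → GeomTangentSpace g x}
    (hA : ChartDifferentiableAt g x₀ A p) (hB : ChartDifferentiableAt g x₀ B p) :
    ChartDifferentiableAt g x₀ (fun x ↦ A x + B x) p := by
  simp only [ChartDifferentiableAt, map_add]
  exact MDifferentiableAt.add hA hB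

theorem chartDeriv_add (a : TangentSpace (𝓡 n) p) {A B : (x : M) → GeomTangentSpace g x}
    (hA : ChartDifferentiableAt g x₀ A p) (hB : ChartDifferentiableAt g x₀ B p) :
    chartDeriv g D' x₀ p a (fun x ↦ A x + B x) =
      chartDeriv g D' x₀ p a A + chartDeriv g D' x₀ p a B := by
  simp only [chartDeriv, map_add]
  rw [mvfderiv_fun_add hA hB, add_apply, map_add]
  abel

theorem chartDeriv_linear (hD' : IsAffineConnection D')
    (hp : p ∈ (chartAt (EuclideanSpace ℝ (Fin n)) x₀).source)
    (a b : TangentSpace (𝓡 n) p) (α β : ℝ) (A : (x : M) → GeomTangentSpace g x) :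
    chartDeriv g D' x₀ p (α • a + β • b) A =
      α • chartDeriv g D' x₀ p a A + β • chartDeriv g D' x₀ p b A := by
  simp only [chartDeriv, connectionForm_linear hD' hp, ExteriorAlgebra.derivation_add,
    ExteriorAlgebra.derivation_smul, map_add, map_smul, smul_add]
  abel

theorem chartDifferentiableAt_smul {φ : M → ℝ} {A : (x : M) → GeomTangentSpace g x}
    (hφ : MDifferentiableAt (𝓡 n) 𝓘(ℝ, ℝ) φ p) (hA : ChartDifferentiableAt g x₀ A p) :
    ChartDifferentiableAt g x₀ (fun x ↦ φ x • A x) p := by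
  simp only [ChartDifferentiableAt, map_smul]
  exact hφ.smul hA

theorem chartDeriv_smul (a : TangentSpace (𝓡 n) p) {φ : M → ℝ}
    {A : (x : M) → GeomTangentSpace g x}
    (hp : p ∈ (chartAt (EuclideanSpace ℝ (Fin n)) x₀).source)
    (hφ : MDifferentiableAt (𝓡 n) 𝓘(ℝ, ℝ) φ p) (hA : ChartDifferentiableAt g x₀ A p) :
    chartDeriv g D' x₀ p a (fun x ↦ φ x • A x) =
      scalarDeriv p a φ • A p + φ p • chartDeriv g D' x₀ p a A := by
  apply toExterior_injective g hp
  simp only [toExterior_chartDeriv hp, map_add, map_smul, mvfderiv_fun_smul hφ hA]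
  simp only [add_apply, smul_apply,
    ContinuousLinearMap.smulRight_apply, scalarDeriv, smul_add]
  abel

theorem toExterior_one (x₀ x : M) : toExterior g x₀ x 1 = 1 := by
  have h := toExterior_scalar g (x₀ := x₀) (x := x) 1
  rwa [map_one (scalarToMultivector g x), map_one (algebraMap ℝ _)] at h

theorem chartDifferentiableAt_one : ChartDifferentiableAt g x₀ (fun _ ↦ 1) p := by
  simp only [ChartDifferentiableAt, toExterior_one]
  exact mdifferentiableAt_const

theorem chartDeriv_one (a : TangentSpace (𝓡 n) p) :
    chartDeriv g D' x₀ p a (fun _ ↦ 1) = 0 := by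
  have h := ExteriorAlgebra.derivation_algebraMap (connectionForm D' x₀ p a) 1
  rw [map_one] at h
  simp only [chartDeriv, toExterior_one, mvfderiv_const, h]
  simp

theorem scalarToMultivector_eq_smul (x : M) (r : ℝ) :
    scalarToMultivector g x r = r • (1 : GeomTangentSpace g x) :=
  Algebra.algebraMap_eq_smul_one r

theorem chartDifferentiableAt_scalar {φ : M → ℝ} (hφ : MDifferentiableAt (𝓡 n) 𝓘(ℝ, ℝ) φ p) :
    ChartDifferentiableAt g x₀ (fun x ↦ scalarToMultivector g x (φ x)) p := by
  simpa only [scalarToMultivector_eq_smul] using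
    chartDifferentiableAt_smul hφ chartDifferentiableAt_one

theorem chartDeriv_scalar (a : TangentSpace (𝓡 n) p) {φ : M → ℝ}
    (hp : p ∈ (chartAt (EuclideanSpace ℝ (Fin n)) x₀).source)
    (hφ : MDifferentiableAt (𝓡 n) 𝓘(ℝ, ℝ) φ p) :
    chartDeriv g D' x₀ p a (fun x ↦ scalarToMultivector g x (φ x)) =
      scalarToMultivector g p (scalarDeriv p a φ) := by
  simp only [scalarToMultivector_eq_smul]
  rw [chartDeriv_smul a hp hφ chartDifferentiableAt_one, chartDeriv_one, smul_zero, add_zero]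

theorem chartDifferentiableAt_vector {v : (x : M) → TangentSpace (𝓡 n) x}
    (hp : p ∈ (chartAt (EuclideanSpace ℝ (Fin n)) x₀).source) (hv : SmoothVectorFieldNear v p) :
    ChartDifferentiableAt g x₀ (fun x ↦ vectorToMultivector g x (v x)) p := by
  obtain ⟨U, hU, hpU, -, hs⟩ := hv.chartComponents hp
  simp only [ChartDifferentiableAt, toExterior_vector]
  exact MDifferentiableAt.clm_comp_apply (LinearMap.toContinuousLinearMap (ExteriorAlgebra.ι ℝ))
    ((hs.contMDiffAt (hU.mem_nhds hpU)).mdifferentiableAt (by simp))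

theorem chartDeriv_vector (hD' : IsAffineConnection D') (a : TangentSpace (𝓡 n) p)
    {v : (x : M) → TangentSpace (𝓡 n) x}
    (hp : p ∈ (chartAt (EuclideanSpace ℝ (Fin n)) x₀).source) (hv : SmoothVectorFieldNear v p) :
    chartDeriv g D' x₀ p a (fun x ↦ vectorToMultivector g x (v x)) =
      vectorToMultivector g p (D' p a v) := by
  apply toExterior_injective g hp
  obtain ⟨U, hU, hpU, -, hs⟩ := hv.chartComponents hp
  have h := mvfderiv_clm_comp (LinearMap.toContinuousLinearMap
    (ExteriorAlgebra.ι ℝ (M := EuclideanSpace ℝ (Fin n))))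
    ((hs.contMDiffAt (hU.mem_nhds hpU)).mdifferentiableAt (by simp)) a
  rw [toExterior_chartDeriv hp]
  simp only [toExterior_vector, chartComponents_connection hD' hp a hv, map_add,
    ExteriorAlgebra.derivation_ι]
  congr 1

/-- Metric compatibility, in the components of a chart. -/
theorem lowerIndex_connection (hcompat : IsMetricCompatible g D')
    (hp : p ∈ (chartAt (EuclideanSpace ℝ (Fin n)) x₀).source) (a : TangentSpace (𝓡 n) p)
    {v : (x : M) → TangentSpace (𝓡 n) x} (hv : SmoothVectorFieldNear v p) (j : Fin n) :
    scalarDeriv p a (fun x ↦ g.inner x (v x) (coordFrame x₀ j x)) =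
      lowerIndex g x₀ p (D' p a v) (stdBasis n j) +
        lowerIndex g x₀ p (v p) (connectionForm D' x₀ p a (stdBasis n j)) := by
  rw [← hcompat p a _ _ hv (smoothVectorFieldNear_coordFrame hp j), lowerIndex_coordFrame g hp,
    connectionForm_stdBasis]
  simp only [lowerIndex, LinearMap.comp_apply, ofChartComponents_chartComponents hp]
  rfl

/-- The product rule for the product of a coordinate vector field and a multivector field. -/
theorem chartDeriv_coordFrame_mul (hcompat : IsMetricCompatible g D')
    (hp : p ∈ (chartAt (EuclideanSpace ℝ (Fin n)) x₀).source) (a : TangentSpace (𝓡 n) p)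
    (i : Fin n) {B : (x : M) → GeomTangentSpace g x} (hB : ChartDifferentiableAt g x₀ B p) :
    ChartDifferentiableAt g x₀
      (fun x ↦ vectorToMultivector g x (coordFrame x₀ i x) * B x) p ∧
    chartDeriv g D' x₀ p a (fun x ↦ vectorToMultivector g x (coordFrame x₀ i x) * B x) =
      vectorToMultivector g p (D' p a (coordFrame x₀ i)) * B p +
        vectorToMultivector g p (coordFrame x₀ i p) * chartDeriv g D' x₀ p a B := by
  have he (j : Fin n) := smoothVectorFieldNear_coordFrame hp j
  let f (x : M) := toExterior g x₀ x (B x)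
  let γ (j : Fin n) (x : M) := g.inner x (coordFrame x₀ i x) (coordFrame x₀ j x)
  let lmul : ExteriorAlgebra ℝ (EuclideanSpace ℝ (Fin n)) →L[ℝ] _ :=
    LinearMap.toContinuousLinearMap (LinearMap.mulLeft ℝ (ExteriorAlgebra.ι ℝ (stdBasis n i)))
  let contr (j : Fin n) : ExteriorAlgebra ℝ (EuclideanSpace ℝ (Fin n)) →L[ℝ] _ :=
    LinearMap.toContinuousLinearMap (ExteriorAlgebra.contract ((stdBasis n).coord j))
  have hf : MDifferentiableAt (𝓡 n) 𝓘(ℝ, ExteriorAlgebra ℝ (EuclideanSpace ℝ (Fin n))) f p := hB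
  have hγ (j : Fin n) : MDifferentiableAt (𝓡 n) 𝓘(ℝ, ℝ) (γ j) p :=
    (smoothScalarFieldNear_inner g (he i) (he j)).mdifferentiableAt
  -- In the chart, the product is a constant linear map applied to `f` plus constant contractions
  -- weighted by the metric coefficients `γ j`.
  have heq : (fun x ↦ toExterior g x₀ x (vectorToMultivector g x (coordFrame x₀ i x) * B x))
      =ᶠ[𝓝 p] fun x ↦ lmul (f x) + ∑ j, γ j x • contr j (f x) := by
    filter_upwards [eventually_mem_chartSource hp] with x hx
    rw [toExterior_vector_mul g hx, chartComponents_coordFrame hx,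
      ExteriorAlgebra.contract_eq_sum (stdBasis n)]
    simp only [lowerIndex_coordFrame g hx]
    rfl
  have hl := hf.clm_comp_apply lmul
  have hterm (j : Fin n) : MDifferentiableAt (𝓡 n)
      𝓘(ℝ, ExteriorAlgebra ℝ (EuclideanSpace ℝ (Fin n))) (fun x ↦ γ j x • contr j (f x)) p :=
    (hγ j).smul (hf.clm_comp_apply (contr j))
  obtain ⟨hs, hs'⟩ := mvfderiv_sum Finset.univ fun j _ ↦ hterm j
  refine ⟨(hl.add hs).congr_of_eventuallyEq heq, ?_⟩
  have hderiv : mvfderiv (𝓡 n) (fun x ↦ lmul (f x) + ∑ j, γ j x • contr j (f x)) p a =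
      ExteriorAlgebra.ι ℝ (stdBasis n i) * mvfderiv (𝓡 n) f p a +
        (ExteriorAlgebra.contract (lowerIndex g x₀ p (coordFrame x₀ i p)) (mvfderiv (𝓡 n) f p a) +
        ExteriorAlgebra.contract (lowerIndex g x₀ p (D' p a (coordFrame x₀ i))) (f p) +
        ExteriorAlgebra.contract (lowerIndex g x₀ p (coordFrame x₀ i p) ∘ₗ
          connectionForm D' x₀ p a) (f p)) := by
    rw [mvfderiv_fun_add hl hs, add_apply, mvfderiv_clm_comp lmul hf]
    congr 1
    refine (congrArg (fun T ↦ T a) hs').trans ?_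
    rw [sum_apply, ExteriorAlgebra.contract_eq_sum (stdBasis n),
      ExteriorAlgebra.contract_eq_sum (stdBasis n), ExteriorAlgebra.contract_eq_sum (stdBasis n),
      ← Finset.sum_add_distrib, ← Finset.sum_add_distrib]
    refine Finset.sum_congr rfl fun j _ ↦ ?_
    refine (congrArg (fun T ↦ T a)
      (mvfderiv_smul (hγ j) (hf.clm_comp_apply (contr j)))).trans ?_
    -- Metric compatibility splits the derivative of `γ j` into the two contractions without a
    -- derivative of `f`.
    have h := lowerIndex_connection hcompat hp a (he i) j
    rw [scalarDeriv] at h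
    simp only [add_apply, smul_apply,
      ContinuousLinearMap.smulRight_apply, mvfderiv_clm_comp (contr j) hf, LinearMap.comp_apply]
    rw [h, lowerIndex_coordFrame g hp (coordFrame x₀ i p), add_smul, add_assoc]
    rfl
  apply toExterior_injective g hp
  -- The contraction of `f p` with `lowerIndex` composed with `connectionForm` occurs twice: with a
  -- plus from the derivative of the metric, with a minus from `derivation_contract`. It cancels.
  rw [toExterior_chartDeriv hp, heq.mvfderiv_eq, hderiv, map_add, toExterior_vector_mul g hp,
    toExterior_vector_mul g hp, toExterior_vector_mul g hp, toExterior_chartDeriv hp,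
    chartComponents_coordFrame hp, map_add, ExteriorAlgebra.derivation_mul,
    ExteriorAlgebra.derivation_ι, ExteriorAlgebra.derivation_contract, connectionForm_stdBasis]
  simp only [mul_add, map_add, f]
  abel

/-! ### The product rule and independence of the chart. -/

variable (D') in
/-- The product rule at `p`, along `a`, for products with `A` on the left. -/
def LeibnizAt (x₀ p : M) (a : TangentSpace (𝓡 n) p) (A : (x : M) → GeomTangentSpace g x) : Prop :=
  ChartDifferentiableAt g x₀ A p ∧ ∀ B : (x : M) → GeomTangentSpace g x,
    ChartDifferentiableAt g x₀ B p → ChartDifferentiableAt g x₀ (fun x ↦ A x * B x) p ∧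
      chartDeriv g D' x₀ p a (fun x ↦ A x * B x) =
        chartDeriv g D' x₀ p a A * B p + A p * chartDeriv g D' x₀ p a B

theorem LeibnizAt.congr {a : TangentSpace (𝓡 n) p} {A A' : (x : M) → GeomTangentSpace g x}
    (hA : LeibnizAt D' x₀ p a A) (h : ∀ᶠ x in 𝓝 p, A x = A' x) : LeibnizAt D' x₀ p a A' := by
  refine ⟨hA.1.congr h, fun B hB ↦ ?_⟩
  obtain ⟨h1, h2⟩ := hA.2 B hB
  have h' : ∀ᶠ x in 𝓝 p, A x * B x = A' x * B x := h.mono fun x hx ↦ by rw [hx]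
  exact ⟨h1.congr h', by
    rw [← chartDeriv_congr a h', h2, chartDeriv_congr a h, h.self_of_nhds]⟩

theorem leibnizAt_scalar (hp : p ∈ (chartAt (EuclideanSpace ℝ (Fin n)) x₀).source)
    (a : TangentSpace (𝓡 n) p) {φ : M → ℝ} (hφ : SmoothScalarFieldNear n φ p) :
    LeibnizAt D' x₀ p a (fun x ↦ scalarToMultivector g x (φ x)) := by
  refine ⟨chartDifferentiableAt_scalar hφ.mdifferentiableAt, fun B hB ↦ ?_⟩
  rw [chartDeriv_scalar a hp hφ.mdifferentiableAt]
  simp only [scalarToMultivector_mul]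
  exact ⟨chartDifferentiableAt_smul hφ.mdifferentiableAt hB,
    chartDeriv_smul a hp hφ.mdifferentiableAt hB⟩

theorem LeibnizAt.add {a : TangentSpace (𝓡 n) p} {A A' : (x : M) → GeomTangentSpace g x}
    (hA : LeibnizAt D' x₀ p a A) (hA' : LeibnizAt D' x₀ p a A') :
    LeibnizAt D' x₀ p a (fun x ↦ A x + A' x) := by
  refine ⟨hA.1.add hA'.1, fun C hC ↦ ?_⟩
  obtain ⟨h1, h2⟩ := hA.2 C hC
  obtain ⟨h3, h4⟩ := hA'.2 C hC
  simp only [add_mul]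
  refine ⟨h1.add h3, ?_⟩
  rw [chartDeriv_add a h1 h3, chartDeriv_add a hA.1 hA'.1, h2, h4, add_mul]
  abel

/-- Associativity: the rule for `A` is applied to the field `A' C`, which need not be smooth. For
this reason `LeibnizAt` admits all differentiable right factors and includes differentiability of
the product. -/
theorem LeibnizAt.mul {a : TangentSpace (𝓡 n) p} {A A' : (x : M) → GeomTangentSpace g x}
    (hA : LeibnizAt D' x₀ p a A) (hA' : LeibnizAt D' x₀ p a A') :
    LeibnizAt D' x₀ p a (fun x ↦ A x * A' x) := by
  refine ⟨(hA.2 A' hA'.1).1, fun C hC ↦ ?_⟩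
  obtain ⟨h1, h2⟩ := hA'.2 C hC
  obtain ⟨h3, h4⟩ := hA.2 _ h1
  simp only [mul_assoc]
  refine ⟨h3, ?_⟩
  rw [h4, h2, (hA.2 A' hA'.1).2, add_mul, mul_add, mul_assoc, mul_assoc, add_assoc]

theorem leibnizAt_coordFrame (hD' : IsAffineConnection D') (hcompat : IsMetricCompatible g D')
    (hp : p ∈ (chartAt (EuclideanSpace ℝ (Fin n)) x₀).source) (a : TangentSpace (𝓡 n) p)
    (i : Fin n) :
    LeibnizAt D' x₀ p a (fun x ↦ vectorToMultivector g x (coordFrame x₀ i x)) := by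
  have he := smoothVectorFieldNear_coordFrame hp i
  refine ⟨chartDifferentiableAt_vector hp he, fun B hB ↦ ?_⟩
  rw [chartDeriv_vector hD' a hp he]
  exact chartDeriv_coordFrame_mul hcompat hp a i hB

/-- Needed for comparing charts: the coordinate vectors of one chart are general vector fields in
another. The field is a sum of products of scalar fields and coordinate vectors. -/
theorem leibnizAt_vector (hD' : IsAffineConnection D') (hcompat : IsMetricCompatible g D')
    (hp : p ∈ (chartAt (EuclideanSpace ℝ (Fin n)) x₀).source) (a : TangentSpace (𝓡 n) p)
    {v : (x : M) → TangentSpace (𝓡 n) x} (hv : SmoothVectorFieldNear v p) :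
    LeibnizAt D' x₀ p a (fun x ↦ vectorToMultivector g x (v x)) := by
  classical
  obtain ⟨U, hU, hpU, hUs, hs⟩ := hv.chartComponents hp
  let ℓ (i : Fin n) : EuclideanSpace ℝ (Fin n) →L[ℝ] ℝ :=
    LinearMap.toContinuousLinearMap ((stdBasis n).coord i)
  have hφ (i : Fin n) : SmoothScalarFieldNear n (fun x ↦ ℓ i (chartComponents x₀ x (v x))) p :=
    ⟨U, hU, hpU, (ℓ i).contMDiff.comp_contMDiffOn hs⟩
  have hsum (s : Finset (Fin n)) : LeibnizAt D' x₀ p a (fun x ↦ ∑ i ∈ s,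
      scalarToMultivector g x (ℓ i (chartComponents x₀ x (v x))) *
        vectorToMultivector g x (coordFrame x₀ i x)) := by
    induction s using Finset.induction_on with
    | empty =>
      simpa only [Finset.sum_empty, map_zero] using leibnizAt_scalar (g := g) hp a
        (φ := fun _ ↦ 0) ⟨Set.univ, isOpen_univ, trivial, contMDiffOn_const⟩
    | insert i s hi ih =>
      simp only [Finset.sum_insert hi]
      exact ((leibnizAt_scalar hp a (hφ i)).mul
        (leibnizAt_coordFrame hD' hcompat hp a i)).add ih
  refine (hsum Finset.univ).congr ?_
  filter_upwards [eventually_mem_chartSource hp] with x hx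
  simp only [scalarToMultivector_mul, ← map_smul, ← map_sum]
  exact congrArg _ (eq_sum_coordFrame hx (v x)).symm

/-- The product rule. -/
theorem SmoothMultivectorFieldNear.leibnizAt (hD' : IsAffineConnection D')
    (hcompat : IsMetricCompatible g D')
    (hp : p ∈ (chartAt (EuclideanSpace ℝ (Fin n)) x₀).source) (a : TangentSpace (𝓡 n) p)
    {A : (x : M) → GeomTangentSpace g x} (hA : SmoothMultivectorFieldNear g A p) :
    LeibnizAt D' x₀ p a A :=
  multivectorField_induction g hp (fun _ _ h hA ↦ hA.congr h) (fun _ ↦ leibnizAt_scalar hp a)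
    (leibnizAt_coordFrame hD' hcompat hp a) (fun _ _ ↦ LeibnizAt.add) (fun _ _ ↦ LeibnizAt.mul) A hA

/-- The derivative of a multivector field does not depend on the chart in which it is computed. -/
theorem chartDeriv_eq (hD' : IsAffineConnection D') (hcompat : IsMetricCompatible g D') {x₁ : M}
    (hp : p ∈ (chartAt (EuclideanSpace ℝ (Fin n)) x₀).source)
    (hp' : p ∈ (chartAt (EuclideanSpace ℝ (Fin n)) x₁).source) (a : TangentSpace (𝓡 n) p)
    {A : (x : M) → GeomTangentSpace g x} (hA : SmoothMultivectorFieldNear g A p) :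
    chartDeriv g D' x₀ p a A = chartDeriv g D' x₁ p a A := by
  -- Equality alone does not pass to products; the product rule in both charts is carried along in
  -- the induction. On vector fields both derivatives are `D'`, which involves no chart.
  suffices h : LeibnizAt D' x₀ p a A ∧ LeibnizAt D' x₁ p a A ∧
      chartDeriv g D' x₀ p a A = chartDeriv g D' x₁ p a A from h.2.2
  refine multivectorField_induction g hp (P := fun A ↦ LeibnizAt D' x₀ p a A ∧
    LeibnizAt D' x₁ p a A ∧ chartDeriv g D' x₀ p a A = chartDeriv g D' x₁ p a A) ?_ ?_ ?_ ?_ ?_ A hA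
  · rintro A B h ⟨h0, h1, he⟩
    exact ⟨h0.congr h, h1.congr h, by rw [← chartDeriv_congr a h, he, chartDeriv_congr a h]⟩
  · intro φ hφ
    refine ⟨leibnizAt_scalar hp a hφ, leibnizAt_scalar hp' a hφ, ?_⟩
    rw [chartDeriv_scalar a hp hφ.mdifferentiableAt, chartDeriv_scalar a hp' hφ.mdifferentiableAt]
  · intro i
    have he := smoothVectorFieldNear_coordFrame hp i
    refine ⟨leibnizAt_vector hD' hcompat hp a he, leibnizAt_vector hD' hcompat hp' a he, ?_⟩
    rw [chartDeriv_vector hD' a hp he, chartDeriv_vector hD' a hp' he]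
  · rintro A B ⟨h0, h1, he⟩ ⟨h0', h1', he'⟩
    refine ⟨h0.add h0', h1.add h1', ?_⟩
    rw [chartDeriv_add a h0.1 h0'.1, chartDeriv_add a h1.1 h1'.1, he, he']
  · rintro A B ⟨h0, h1, he⟩ ⟨h0', h1', he'⟩
    refine ⟨h0.mul h0', h1.mul h1', ?_⟩
    rw [(h0.2 B h0'.1).2, (h1.2 B h1'.1).2, he, he']

/-! ### Smoothness of the derivative. -/

/-- The coefficients of a smooth connection are smooth. -/
theorem PreservesSmoothVectorFields.derivation (hD : PreservesSmoothVectorFields D')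
    {U : Set M} (hU : IsOpen U) (hU' : U ⊆ (chartAt (EuclideanSpace ℝ (Fin n)) x₀).source)
    {a : (x : M) → TangentSpace (𝓡 n) x} (ha : SmoothVectorFieldOn a U)
    (y : ExteriorAlgebra ℝ (EuclideanSpace ℝ (Fin n))) :
    ContMDiffOn (𝓡 n) 𝓘(ℝ, ExteriorAlgebra ℝ (EuclideanSpace ℝ (Fin n))) ∞
      (fun x ↦ ExteriorAlgebra.derivation (connectionForm D' x₀ x (a x)) y) U := by
  let lmul (z : ExteriorAlgebra ℝ (EuclideanSpace ℝ (Fin n))) :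
      ExteriorAlgebra ℝ (EuclideanSpace ℝ (Fin n)) →L[ℝ] _ :=
    LinearMap.toContinuousLinearMap (LinearMap.mulLeft ℝ z)
  let rmul (z : ExteriorAlgebra ℝ (EuclideanSpace ℝ (Fin n))) :
      ExteriorAlgebra ℝ (EuclideanSpace ℝ (Fin n)) →L[ℝ] _ :=
    LinearMap.toContinuousLinearMap (LinearMap.mulRight ℝ z)
  induction y using ExteriorAlgebra.induction with
  | algebraMap r =>
    simp only [ExteriorAlgebra.derivation_algebraMap]
    exact contMDiffOn_const
  | ι v =>
    have h (i : Fin n) : ContMDiffOn (𝓡 n) 𝓘(ℝ, EuclideanSpace ℝ (Fin n)) ∞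
        (fun x ↦ connectionForm D' x₀ x (a x) (stdBasis n i)) U := by
      simp only [connectionForm_stdBasis]
      exact SmoothVectorFieldOn.chartComponents hU hU'
        (hD U a _ hU ha ((smoothVectorFieldOn_coordFrame x₀ i).mono hU'))
    have hv : ContMDiffOn (𝓡 n) 𝓘(ℝ, EuclideanSpace ℝ (Fin n)) ∞
        (fun x ↦ ∑ i, (stdBasis n).repr v i • connectionForm D' x₀ x (a x) (stdBasis n i)) U :=
      contMDiffOn_finsetSum fun i _ ↦
        (((stdBasis n).repr v i • ContinuousLinearMap.id ℝ
          (EuclideanSpace ℝ (Fin n))).contMDiff).comp_contMDiffOn (h i)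
    simp only [← map_smul, ← map_sum, (stdBasis n).sum_repr] at hv
    simp only [ExteriorAlgebra.derivation_ι]
    exact (LinearMap.toContinuousLinearMap (ExteriorAlgebra.ι ℝ
      (M := EuclideanSpace ℝ (Fin n)))).contMDiff.comp_contMDiffOn hv
  | mul y z hy hz =>
    simp only [ExteriorAlgebra.derivation_mul]
    exact ((rmul z).contMDiff.comp_contMDiffOn hy).add ((lmul y).contMDiff.comp_contMDiffOn hz)
  | add y z hy hz =>
    simp only [map_add]
    exact hy.add hz

theorem smoothMultivectorFieldOn_chartDeriv (hD' : IsAffineConnection D')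
    (hcompat : IsMetricCompatible g D') (hD : PreservesSmoothVectorFields D') :
    PreservesSmoothMultivectorFields g (fun p a A ↦ chartDeriv g D' p p a A) := by
  intro U a A hU ha hA x₀
  obtain ⟨c, hc, hAc⟩ := hA x₀
  have ho := hU.inter (chartAt (EuclideanSpace ℝ (Fin n)) x₀).open_source
  let V := U ∩ (chartAt (EuclideanSpace ℝ (Fin n)) x₀).source
  -- The derivative of `∑ c_J e_J` as read in the fixed chart at `x₀`; its coordinates are the
  -- required coefficients.
  let F (x : M) : ExteriorAlgebra ℝ (EuclideanSpace ℝ (Fin n)) :=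
    ∑ J, (scalarDeriv x (a x) (c J) • exteriorBasis n J +
      c J x • ExteriorAlgebra.derivation (connectionForm D' x₀ x (a x)) (exteriorBasis n J))
  have haV : SmoothVectorFieldOn a V := ha.mono Set.inter_subset_left
  have hF : ContMDiffOn (𝓡 n) 𝓘(ℝ, ExteriorAlgebra ℝ (EuclideanSpace ℝ (Fin n))) ∞ F V :=
    contMDiffOn_finsetSum fun J _ ↦ (((hc J).mvfderiv_apply ho haV).smul contMDiffOn_const).add
      ((hc J).smul (hD.derivation ho Set.inter_subset_right haV _))
  refine ⟨fun J x ↦ (exteriorBasis n).coord J (F x), fun J ↦ ?_, fun x hx ↦ ?_⟩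
  · exact (LinearMap.toContinuousLinearMap ((exteriorBasis n).coord J)).contMDiff.comp_contMDiffOn
      hF
  · change chartDeriv g D' x x (a x) A = _
    -- The derivative at `x` is defined with the chart at `x`, which varies with the point; it is
    -- replaced by the fixed chart at `x₀`.
    rw [chartDeriv_eq hD' hcompat (mem_chart_source _ x) hx.2 (a x) ⟨U, hU, hx.1, hA⟩]
    apply toExterior_injective g hx.2
    have hterm (J : Finset (Fin n)) : MDifferentiableAt (𝓡 n)
        𝓘(ℝ, ExteriorAlgebra ℝ (EuclideanSpace ℝ (Fin n)))
        (fun y ↦ c J y • exteriorBasis n J) x :=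
      (((hc J).contMDiffAt (ho.mem_nhds hx)).mdifferentiableAt (by simp)).smul
        mdifferentiableAt_const
    have heq : (fun y ↦ toExterior g x₀ y (A y)) =ᶠ[𝓝 x]
        fun y ↦ ∑ J, c J y • exteriorBasis n J := by
      filter_upwards [ho.mem_nhds hx] with y hy
      simp only [hAc y hy, map_sum, map_smul, multivectorCoordFrame_eq g hy.2,
        toExterior_ofExterior g hy.2]
    have hd := (mvfderiv_sum Finset.univ fun J _ ↦ hterm J).2
    rw [toExterior_chartDeriv hx.2, heq.mvfderiv_eq, hd, heq.eq_of_nhds]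
    simp only [map_sum, map_smul, multivectorCoordFrame_eq g hx.2, toExterior_ofExterior g hx.2]
    refine Eq.trans ?_ ((exteriorBasis n).sum_repr (F x)).symm
    rw [sum_apply, ← Finset.sum_add_distrib]
    refine Finset.sum_congr rfl fun J _ ↦ ?_
    rw [mvfderiv_fun_smul (((hc J).contMDiffAt (ho.mem_nhds hx)).mdifferentiableAt (by simp))
      mdifferentiableAt_const, mvfderiv_const]
    simp [scalarDeriv]

end MultivectorDerivative
end

theorem mainTheorem1 {n : ℕ} {M : Type*} [TopologicalSpace M]
    [ChartedSpace (EuclideanSpace ℝ (Fin n)) M] [IsManifold (𝓡 n) ∞ M]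
    (g : PseudoRiemannianMetric n M)
    (D' : (p : M) → TangentSpace (𝓡 n) p → ((x : M) → TangentSpace (𝓡 n) x) →
      TangentSpace (𝓡 n) p)
    (hD' : IsAffineConnection D') (hcompat : IsMetricCompatible g D') :
    ∃ D : (p : M) → TangentSpace (𝓡 n) p → ((x : M) → GeomTangentSpace g x) →
        GeomTangentSpace g p,
      IsMultivectorDirectionalDerivative g D ∧
      (∀ (p : M) (a : TangentSpace (𝓡 n) p) (v : (x : M) → TangentSpace (𝓡 n) x),
        SmoothVectorFieldNear v p →
        D p a (fun x ↦ vectorToMultivector g x (v x)) = vectorToMultivector g p (D' p a v)) ∧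
      (PreservesSmoothVectorFields D' → PreservesSmoothMultivectorFields g D) := by
  have hp (p : M) := mem_chart_source (EuclideanSpace ℝ (Fin n)) p
  -- Each axiom concerns a single point `p`, so the preferred chart at `p` suffices and nothing has
  -- to be glued. Charts are compared only for smoothness.
  refine ⟨fun p a A ↦ chartDeriv g D' p p a A, ⟨?_, ?_, ?_, ?_, ?_⟩, ?_,
    smoothMultivectorFieldOn_chartDeriv hD' hcompat⟩
  · exact fun p a b α β A _ ↦ chartDeriv_linear hD' (hp p) a b α β A
  · exact fun p a φ hφ ↦ chartDeriv_scalar a (hp p) hφ.mdifferentiableAt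
  · exact fun p a v hv ↦ ⟨D' p a v, chartDeriv_vector hD' a (hp p) hv⟩
  · exact fun p a A B hA hB ↦ chartDeriv_add a (hA.leibnizAt hD' hcompat (hp p) a).1
      (hB.leibnizAt hD' hcompat (hp p) a).1
  · exact fun p a A B hA hB ↦ ((hA.leibnizAt hD' hcompat (hp p) a).2 B
      (hB.leibnizAt hD' hcompat (hp p) a).1).2
  · exact fun p a v hv ↦ chartDeriv_vector hD' a (hp p) hv
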